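/- Let $\mathcal{A}$ and $\mathcal{B}$ be abelian categories with enough projective objects, and let $\underline{\mathcal{A}}$, $\underline{\mathcal{B}}$ be their stable categories (same objects; morphisms modulo those factoring through a projective object). Let $F: D^b(\mathcal{A})\to D^b(\mathcal{B})$ be a triangle functor which is non-negative, that is: (1) for every $X\in\mathcal{A}$, the complex $F(X)$ has zero cohomology in all negative degrees; (2) for every projective object $P$ of $\mathcal{A}$, $F(P)$ is isomorphic in $D^b(\mathcal{B})$ to a bounded complex of projective objects of $\mathcal{B}$ with zero terms in all negative degrees. For each $X\in\mathcal{A}$ fix a distinguished triangle $$U_X\longrightarrow F(X)\stackrel{\pi_X}{\longrightarrow} M_X\longrightarrow U_X[1]$$ in $D^b(\mathcal{B})$ with $M_X\in\mathcal{B}$ and $U_X$ isomorphic to a complex $0\to U^1\to\cdots\to U^{n}\to 0$ of projective objects of $\mathcal{B}$ placed in degrees $1,\dots,n$, for some $n=n_X>0$ (such triangles always exist). The stable functor $\bar F:\underline{\mathcal{A}}\to\underline{\mathcal{B}}$ is defined by $\bar F(X)=M_X$ and $\bar F(\underline f)=\underline b$ for $f:X\to Y$ in $\mathcal{A}$, where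 $b:M_X\to M_Y$ is any morphism of $\mathcal{B}$ for which the composite $F(X)\stackrel{\pi_X}{\to}M_X\stackrel{b}{\to}M_Y$ equals the composite $F(X)\stackrel{F(f)}{\to}F(Y)\stackrel{\pi_Y}{\to}M_Y$ (such a $b$ exists, and $\underline b$ depends only on $\underline f$). Let $\Omega_{\mathcal{A}}:\underline{\mathcal{A}}\to\underline{\mathcal{A}}$ and $\Omega_{\mathcal{B}}:\underline{\mathcal{B}}\to\underline{\mathcal{B}}$ be the syzygy functors: fixing for each object $X$ an epimorphism $P_X\to X$ with $P_X$ projective, $\Omega(X)=\ker(P_X\to X)$, and $\Omega(\underline f)$ is the class of the map on kernels induced by any lift of $f:X\to Y$ to a morphism $P_X\to P_Y$. Then, for all choices made above, there is an isomorphism of functors $\underline{\mathcal{A}}\to\underline{\mathcal{B}}$: $$\bar F\circ\Omega_{\mathcal{A}}\;\cong\;\Omega_{\mathcal{B}}\circ\bar F .$$ -/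

import Mathlib

open CategoryTheory CategoryTheory.Limits CategoryTheory.Pretriangulated

universe w₁ w₂ v₁ v₂ u₁ u₂

noncomputable section

namespace StableCat

/-! ### The stable category of an abelian category -/

section

variable (C : Type u₁) [Category.{v₁} C] [Abelian C]

/-- Two parallel morphisms are identified when their difference factors through a
projective object. -/
def projRel : HomRel C := fun X Y f g =>
  ∃ (P : C) (_ : Projective P) (a : X ⟶ P) (b : P ⟶ Y), f - g = a ≫ b

variable {C}

lemma projRel.add {X Y : C} {f₁ f₂ g₁ g₂ : X ⟶ Y} (h : projRel C f₁ f₂) (h' : projRel C g₁ g₂) :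
    projRel C (f₁ + g₁) (f₂ + g₂) := by
  obtain ⟨P, _, a, b, e⟩ := h
  obtain ⟨P', _, a', b', e'⟩ := h'
  refine ⟨P ⊞ P', inferInstance, biprod.lift a a', biprod.desc b b', ?_⟩
  rw [biprod.lift_desc, ← e, ← e']
  abel

instance projRel.congruence : Congruence (projRel C) where
  equivalence :=
    { refl := fun f => ⟨_, Projective.zero_projective, 0, 0, by simp⟩
      symm := by
        rintro f g ⟨P, _, a, b, e⟩
        exact ⟨P, inferInstance, a, -b, by rw [Preadditive.comp_neg, ← e]; abel⟩
      trans := by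
        rintro f g h ⟨P, hP, a, b, e⟩ ⟨P', hP', a', b', e'⟩
        refine ⟨P ⊞ P', inferInstance, biprod.lift a a', biprod.desc b b', ?_⟩
        rw [biprod.lift_desc, ← e, ← e']
        abel }
  comp_left := by
    rintro X Y Z f g g' ⟨P, hP, a, b, e⟩
    exact ⟨P, hP, f ≫ a, b, by rw [← Preadditive.comp_sub, e, Category.assoc]⟩
  comp_right := by
    rintro X Y Z f f' g ⟨P, hP, a, b, e⟩
    exact ⟨P, hP, a, b ≫ g, by rw [← Preadditive.sub_comp, e, Category.assoc]⟩

variable (C)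

/-- The stable category of `C`: the objects are those of `C`, and the morphisms are the morphisms
of `C` modulo those which factor through a projective object. -/
abbrev StableCategory : Type u₁ := CategoryTheory.Quotient (projRel C)

/-- The additive structure of the stable category. -/
instance : Preadditive (StableCategory C) :=
  CategoryTheory.Quotient.preadditive (projRel C) (fun _ _ _ _ _ _ h h' => h.add h')

/-- The projection functor from `C` to its stable category. -/
abbrev toStable : C ⥤ StableCategory C := CategoryTheory.Quotient.functor (projRel C)

variable {C}

lemma toStable_map_eq_iff {X Y : C} (f g : X ⟶ Y) :
    (toStable C).map f = (toStable C).map g ↔ projRel C f g :=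
  CategoryTheory.Quotient.functor_map_eq_iff _ _ _

end

/-! ### The syzygy functor -/

section

variable {C : Type u₁} [Category.{v₁} C] [Abelian C] (p : ∀ X : C, ProjectivePresentation X)

/-- The syzygy of `X`: the kernel of the chosen epimorphism from a projective object to `X`. -/
abbrev syzygyObj (X : C) : C := kernel (p X).f

/-- The morphism of syzygies induced by a morphism of `C` and a choice of a lift of this morphism
to the projective covers. -/
def syzygyMap {X Y : C} (f : X ⟶ Y) : syzygyObj p X ⟶ syzygyObj p Y :=
  kernel.map (p X).f (p Y).f (Projective.factorThru ((p X).f ≫ f) (p Y).f) f (by simp)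

/-- Any map on the kernels that extends to a map of presentations over `f`
represents the syzygy of `f`. -/
lemma syzygyMap_unique {X Y : C} (f g : X ⟶ Y) (l : (p X).p ⟶ (p Y).p)
    (hl : l ≫ (p Y).f = (p X).f ≫ g) (m : syzygyObj p X ⟶ syzygyObj p Y)
    (hm : m ≫ kernel.ι (p Y).f = kernel.ι (p X).f ≫ l) (hfg : projRel C f g) :
    (toStable C).map (syzygyMap p f) = (toStable C).map m := by
  rw [toStable_map_eq_iff]
  obtain ⟨P, hP, a, b, e⟩ := hfg
  have hb := Projective.factorThru_comp b (p Y).f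
  set b' := Projective.factorThru b (p Y).f
  set t := Projective.factorThru ((p X).f ≫ f) (p Y).f with ht
  have ht' : t ≫ (p Y).f = (p X).f ≫ f := Projective.factorThru_comp _ _
  have hk : (t - l - (p X).f ≫ a ≫ b') ≫ (p Y).f = 0 := by
    simp only [Preadditive.sub_comp, Category.assoc, hb, ht', hl, ← e, Preadditive.comp_sub]
    abel
  refine ⟨(p X).p, inferInstance, kernel.ι _, kernel.lift (p Y).f _ hk, ?_⟩
  rw [← cancel_mono (kernel.ι (p Y).f)]
  simp [syzygyMap, hm, Preadditive.sub_comp, Preadditive.comp_sub, ht]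

/-- The syzygy functor `Ω` on the stable category, attached to the chosen epimorphisms from
projective objects. -/
def syzygyFunctor : StableCategory C ⥤ StableCategory C :=
  CategoryTheory.Quotient.lift (projRel C)
    { obj := fun X => (toStable C).obj (syzygyObj p X)
      map := fun f => (toStable C).map (syzygyMap p f)
      map_id := fun X => by
        rw [← (toStable C).map_id]
        exact syzygyMap_unique p _ (𝟙 X) (𝟙 _) (by simp) _ (by simp)
          (projRel.congruence.equivalence.refl _)
      map_comp := fun {X Y Z} f g => by
        rw [← (toStable C).map_comp]
        exact syzygyMap_unique p _ (f ≫ g)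
          (Projective.factorThru ((p X).f ≫ f) (p Y).f ≫
            Projective.factorThru ((p Y).f ≫ g) (p Z).f) (by simp) _ (by simp [syzygyMap])
          (projRel.congruence.equivalence.refl _) }
    (fun X Y f g h => syzygyMap_unique p f g
      (Projective.factorThru ((p X).f ≫ g) (p Y).f) (by simp) _ (by simp [syzygyMap]) h)

end

/-! ### Bounded complexes of projective objects in the derived category -/

section

open DerivedCategory

variable {C : Type u₁} [Category.{v₁} C] [Abelian C] [HasDerivedCategory.{w₁} C]

/-- The object `X` of the derived category is isomorphic to a complex with projective terms
of the form `0 ⟶ K^a ⟶ ⋯ ⟶ K^b ⟶ 0`. -/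
def HasProjForm (a b : ℤ) (X : DerivedCategory C) : Prop :=
  ∃ K : CochainComplex C ℤ, K.IsStrictlyGE a ∧ K.IsStrictlyLE b ∧
    (∀ i, Projective (K.X i)) ∧ Nonempty (X ≅ Q.obj K)

lemma HasProjForm.of_iso {a b : ℤ} {X Y : DerivedCategory C} (e : X ≅ Y)
    (h : HasProjForm a b X) : HasProjForm a b Y := by
  obtain ⟨K, h₁, h₂, h₃, ⟨e'⟩⟩ := h
  exact ⟨K, h₁, h₂, h₃, ⟨e.symm ≪≫ e'⟩⟩

lemma HasProjForm.shift {a b : ℤ} {X : DerivedCategory C} (h : HasProjForm a b X)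
    (n a' b' : ℤ) (ha : n + a' = a) (hb : n + b' = b) : HasProjForm a' b' (X⟦n⟧) := by
  obtain ⟨K, h₁, h₂, h₃, ⟨e⟩⟩ := h
  exact ⟨K⟦n⟧, K.isStrictlyGE_shift a n a' ha, K.isStrictlyLE_shift b n b' hb,
    fun i => h₃ (i + n), ⟨(shiftFunctor _ n).mapIso e ≪≫ (Q.commShiftIso n).symm.app K⟩⟩

/-- Morphisms in the derived category from a bounded above complex of projective objects are
induced by morphisms of complexes. -/
lemma exists_Q_map_eq {K L : CochainComplex C ℤ} (b : ℤ) [K.IsStrictlyLE b]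
    (hK : ∀ i, Projective (K.X i)) (f : Q.obj K ⟶ Q.obj L) : ∃ φ : K ⟶ L, Q.map φ = f := by
  have := CochainComplex.isKProjective_of_projective K b
  obtain ⟨g, hg⟩ := (CochainComplex.IsKProjective.Qh_map_bijective K
    ((HomotopyCategory.quotient _ _).obj L)).surjective
      ((quotientCompQhIso C).hom.app K ≫ f ≫ (quotientCompQhIso C).inv.app L)
  obtain ⟨φ, rfl⟩ := (HomotopyCategory.quotient _ _).map_surjective g
  refine ⟨φ, ?_⟩
  have h := quotientCompQhIso_hom_naturality (C := C) φ
  rw [hg] at h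
  simpa using h.symm

lemma HasProjForm.hom_single_eq_zero {a b : ℤ} {X : DerivedCategory C} (h : HasProjForm a b X)
    {j : ℤ} (hj : j < a) {Y : C} (f : X ⟶ (singleFunctor C j).obj Y) : f = 0 := by
  obtain ⟨K, _, _, hK, ⟨e⟩⟩ := h
  obtain ⟨φ, hφ⟩ := exists_Q_map_eq (L := (HomologicalComplex.single C _ j).obj Y) b hK (e.inv ≫ f)
  have : φ = 0 :=
    HomologicalComplex.to_single_hom_ext ((K.isZero_of_isStrictlyGE a j hj).eq_of_src _ _)
  rw [this, Functor.map_zero] at hφ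
  rw [← cancel_epi e.inv, comp_zero]
  exact hφ.symm

/-- A composition of a morphism from an object to a bounded complex of projective objects in
non-negative degrees, followed by a morphism to an object, factors through a projective object. -/
lemma HasProjForm.exists_factorization {b : ℤ} {X : DerivedCategory C} (h : HasProjForm 0 b X)
    {Y Z : C} (f : (singleFunctor C 0).obj Y ⟶ X) (g : X ⟶ (singleFunctor C 0).obj Z) :
    ∃ (P : C) (_ : Projective P) (u : Y ⟶ P) (v : P ⟶ Z),
      f ≫ g = (singleFunctor C 0).map (u ≫ v) := by
  obtain ⟨K, _, _, hK, ⟨e⟩⟩ := h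
  obtain ⟨φ, hφ⟩ := exists_Q_map_eq (L := (HomologicalComplex.single C _ 0).obj Z) b hK (e.inv ≫ g)
  let α : K ⟶ (HomologicalComplex.single C _ 0).obj (K.X 0) :=
    HomologicalComplex.mkHomToSingle (𝟙 _) (fun i hi => by
      have : i < 0 := by simp at hi; lia
      exact (K.isZero_of_isStrictlyGE 0 i this).eq_of_src _ _)
  let β : K.X 0 ⟶ Z := φ.f 0 ≫ (HomologicalComplex.singleObjXSelf _ 0 Z).hom
  have hαβ : α ≫ (HomologicalComplex.single C _ 0).map β = φ := by
    apply HomologicalComplex.to_single_hom_ext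
    simp [α, β, HomologicalComplex.single_map_f_self]
  let α' : Q.obj K ⟶ (singleFunctor C 0).obj (K.X 0) := Q.map α
  have h₁ : α' ≫ (singleFunctor C 0).map β = e.inv ≫ g := by
    refine Eq.trans ?_ hφ
    exact (Q.map_comp α _).symm.trans (Q.congr_map hαβ)
  obtain ⟨u, hu⟩ := (singleFunctor C 0).map_surjective (f ≫ e.hom ≫ α')
  refine ⟨K.X 0, hK 0, u, β, ?_⟩
  rw [Functor.map_comp, hu, Category.assoc, Category.assoc, h₁, Iso.hom_inv_id_assoc]

/-- The embedding of an abelian category in its bounded derived category, as complexes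
concentrated in degree zero. -/
def toBounded (C : Type u₁) [Category.{v₁} C] [Abelian C] [HasDerivedCategory.{w₁} C] :
    C ⥤ DerivedCategory.Bounded C :=
  TStructure.t.bounded.lift (singleFunctor C 0)
    (fun _ => ⟨⟨0, inferInstance⟩, ⟨0, inferInstance⟩⟩)

instance : (toBounded C).Full :=
  ⟨fun f => by
    obtain ⟨g, hg⟩ := (singleFunctor C 0).map_surjective (Bounded.ι.map f)
    exact ⟨g, Bounded.ι.map_injective hg⟩⟩

instance : (toBounded C).Faithful :=
  ⟨fun h => (singleFunctor C 0).map_injective (Bounded.ι.congr_map h)⟩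

instance : (toBounded C).Additive :=
  ⟨fun {_ _ _ _} => Bounded.ι.map_injective ((singleFunctor C 0).map_add)⟩

end

/-! ### Existence of the triangles used in the definition of the stable functor -/

section

open DerivedCategory
open scoped ZeroObject

variable {C : Type u₁} [Category.{v₁} C] [Abelian C] [HasDerivedCategory.{w₁} C]

lemma HasProjForm.mono {a b a' b' : ℤ} {X : DerivedCategory C} (h : HasProjForm a b X)
    (ha : a' ≤ a) (hb : b ≤ b') : HasProjForm a' b' X := by
  obtain ⟨K, _, _, h₃, e⟩ := h
  exact ⟨K, K.isStrictlyGE_of_ge a' a ha, K.isStrictlyLE_of_le b b' hb, h₃, e⟩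

lemma hasProjForm_single (P : C) [Projective P] (n : ℤ) :
    HasProjForm n n ((singleFunctor C n).obj P) := by
  refine ⟨(HomologicalComplex.single C _ n).obj P, ?_, ?_, fun i => ?_, ⟨Iso.refl _⟩⟩
  · exact inferInstanceAs (((CochainComplex.singleFunctor C n).obj P).IsStrictlyGE n)
  · exact inferInstanceAs (((CochainComplex.singleFunctor C n).obj P).IsStrictlyLE n)
  · by_cases hi : i = n
    · subst hi
      exact Projective.of_iso (HomologicalComplex.singleObjXSelf _ i P).symm inferInstance
    · exact (HomologicalComplex.isZero_single_obj_X _ n P i hi).projective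

lemma HasProjForm.ext₂ {a b : ℤ} (T : Triangle (DerivedCategory C)) (hT : T ∈ distTriang _)
    (h₁ : HasProjForm a b T.obj₁) (h₃ : HasProjForm a b T.obj₃) : HasProjForm a b T.obj₂ := by
  obtain ⟨K, _, _, hK, ⟨e⟩⟩ := h₁
  obtain ⟨L, _, _, hL, ⟨e'⟩⟩ :=
    h₃.shift (-1) (a + 1) (b + 1) (by lia) (by lia)
  obtain ⟨φ, hφ⟩ := exists_Q_map_eq (b + 1) hL (e'.inv ≫ T.invRotate.mor₁ ≫ e.hom)
  refine ⟨CochainComplex.mappingCone φ, ?_, ?_, fun i => ?_, ⟨?_⟩⟩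
  · rw [CochainComplex.isStrictlyGE_iff]
    intro i hi
    rw [CochainComplex.mappingCone.isZero_X_iff]
    exact ⟨L.isZero_of_isStrictlyGE (a + 1) _ (by lia), K.isZero_of_isStrictlyGE a _ hi⟩
  · rw [CochainComplex.isStrictlyLE_iff]
    intro i hi
    rw [CochainComplex.mappingCone.isZero_X_iff]
    exact ⟨L.isZero_of_isStrictlyLE (b + 1) _ (by lia), K.isZero_of_isStrictlyLE b _ hi⟩
  · have := hK i
    have := hL (i + 1)
    exact Projective.of_iso (HomologicalComplex.homotopyCofiber.XIsoBiprod φ i (i + 1) rfl).symm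
      inferInstance
  · exact Triangle.π₃.mapIso (isoTriangleOfIso₁₂ _ _ (inv_rot_of_distTriang _ hT)
      (mappingCone_triangle_distinguished φ) e' e (by
        change T.invRotate.mor₁ ≫ e.hom = e'.hom ≫ Q.map φ
        rw [hφ, Iso.hom_inv_id_assoc]
        rfl))

lemma isZero_homology_single (P : C) (n i : ℤ) (hi : i ≠ n) :
    IsZero ((homologyFunctor C i).obj ((singleFunctor C n).obj P)) := by
  rcases lt_or_gt_of_ne hi with h | h
  · exact ((singleFunctor C n).obj P).isZero_of_isGE n i h
  · exact ((singleFunctor C n).obj P).isZero_of_isLE n i h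

/-- An object concentrated in degrees `≤ n` receives a morphism from a projective object
placed in degree `n` which is an epimorphism on the cohomology in degree `n`. -/
lemma exists_epi_homology [EnoughProjectives C] (X : DerivedCategory C) (n : ℤ) [X.IsLE n] :
    ∃ (P : C) (_ : Projective P) (f : (singleFunctor C n).obj P ⟶ X),
      Epi ((homologyFunctor C n).map f) := by
  obtain ⟨K, _, ⟨e⟩⟩ := exists_iso_Q_obj_of_isLE X n
  have hd : K.d n (n + 1) = 0 :=
    (K.isZero_of_isStrictlyLE n (n + 1) (by lia)).eq_of_tgt _ _
  let φ : (HomologicalComplex.single C (ComplexShape.up ℤ) n).obj (Projective.over (K.X n)) ⟶ K :=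
    HomologicalComplex.mkHomFromSingle (Projective.π (K.X n)) (fun k hk => by
      obtain rfl : n + 1 = k := hk
      rw [hd, comp_zero])
  have hφ : Epi (φ.f n) := by
    simp only [φ, HomologicalComplex.mkHomFromSingle_f]
    infer_instance
  have := K.isIso_iCycles n (n + 1) (by simp) hd
  have : IsIso (((HomologicalComplex.single C (ComplexShape.up ℤ) n).obj
      (Projective.over (K.X n))).iCycles n) :=
    HomologicalComplex.isIso_iCycles _ n (n + 1) (by simp)
      ((HomologicalComplex.isZero_single_obj_X _ _ _ _ (by lia)).eq_of_tgt _ _)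
  have h₁ : Epi (HomologicalComplex.cyclesMap φ n) := by
    have : Epi (HomologicalComplex.cyclesMap φ n ≫ K.iCycles n) := by
      rw [HomologicalComplex.cyclesMap_i]
      infer_instance
    have h : HomologicalComplex.cyclesMap φ n =
        (HomologicalComplex.cyclesMap φ n ≫ K.iCycles n) ≫ inv (K.iCycles n) := by
      rw [Category.assoc, IsIso.hom_inv_id, Category.comp_id]
    rw [h]
    infer_instance
  have h₂ : Epi (HomologicalComplex.homologyMap φ n) := by
    have : Epi (HomologicalComplex.homologyπ _ n ≫ HomologicalComplex.homologyMap φ n) := by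
      rw [HomologicalComplex.homologyπ_naturality]
      infer_instance
    exact epi_of_epi (HomologicalComplex.homologyπ _ n) _
  have h₃ : Epi ((homologyFunctor C n).map (Q.map φ)) :=
    ((MorphismProperty.epimorphisms C).arrow_iso_iff
      (((Functor.mapArrowFunctor _ _).mapIso (homologyFunctorFactors C n)).app (Arrow.mk φ))).2 h₂
  refine ⟨Projective.over (K.X n), inferInstance, Q.map φ ≫ e.inv, ?_⟩
  have h₄ : (homologyFunctor C n).map (Q.map φ ≫ e.inv) =
    (homologyFunctor C n).map (Q.map φ) ≫ (homologyFunctor C n).map e.inv := Functor.map_comp _ _ _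
  have := epi_comp ((homologyFunctor C n).map (Q.map φ)) ((homologyFunctor C n).map e.inv)
  exact h₄ ▸ this

lemma exists_triangle [EnoughProjectives C] (n : ℕ) (X : DerivedCategory C) (h₀ : X.IsGE 0)
    (h₁ : X.IsLE n) : ∃ (M : C) (Z : DerivedCategory C) (π : X ⟶ (singleFunctor C 0).obj M)
      (v : (singleFunctor C 0).obj M ⟶ Z) (w : Z ⟶ X⟦(1 : ℤ)⟧),
      Triangle.mk π v w ∈ distTriang _ ∧ HasProjForm 0 n Z := by
  induction n generalizing X with
  | zero =>
    have h₁' : X.IsLE 0 := by simpa using h₁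
    obtain ⟨M, ⟨e⟩⟩ := exists_iso_singleFunctor_obj_of_isGE_of_isLE X 0
    obtain ⟨Z, v, w, h⟩ := distinguished_cocone_triangle e.hom
    have hZ : IsZero Z := Triangle.isZero₃_of_isIso₁ _ h (inferInstanceAs (IsIso e.hom))
    exact ⟨M, Z, e.hom, v, w, h, ((hasProjForm_single (0 : C) 0).of_iso
      (((singleFunctor C 0).map_isZero (isZero_zero C)).iso hZ))⟩
  | succ n ih =>
    push_cast at h₁
    obtain ⟨P, _, f, hf⟩ := exists_epi_homology X (n + 1)
    obtain ⟨T, g, h, hT⟩ := distinguished_cocone_triangle f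
    have hPz : HasProjForm n n (((singleFunctor C (n + 1)).obj P)⟦(1 : ℤ)⟧) :=
      (hasProjForm_single P _).shift 1 n n (by lia) (by lia)
    have hT₀ : T.IsGE 0 := by
      refine TStructure.t.isGE₂ _ (rot_of_distTriang _ hT) 0 h₀ ?_
      have := TStructure.t.isGE_shift ((singleFunctor C (n + 1)).obj P) (n + 1) 1 n (by lia)
      exact TStructure.t.isGE_of_ge (((singleFunctor C (n + 1)).obj P)⟦(1 : ℤ)⟧) 0 n (by lia)
    have hT₁ : T.IsLE n := by
      rw [isLE_iff]
      intro i hi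
      have e₁ : (homologyFunctor C i).map g = 0 := by
        by_cases hi' : i = n + 1
        · subst hi'
          exact (HomologySequence.epi_homologyMap_mor₁_iff _ hT _).1 hf
        · exact (X.isZero_of_isLE (n + 1) i (by lia)).eq_of_src _ _
      have e₂ : Epi ((homologyFunctor C i).map g) :=
        (HomologySequence.epi_homologyMap_mor₂_iff _ hT i (i + 1) rfl).2
          ((isZero_homology_single P (n + 1) (i + 1) (by lia)).eq_of_tgt _ _)
      rw [e₁] at e₂
      exact @IsZero.of_epi_eq_zero _ _ _ _ _ 0 e₂ rfl
    obtain ⟨M, Z, π, v, w, h', hZ⟩ := ih T hT₀ hT₁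
    obtain ⟨Z', v', w', h''⟩ := distinguished_cocone_triangle (g ≫ π)
    have o := Triangulated.someOctahedron rfl (rot_of_distTriang _ hT) h' h''
    refine ⟨M, Z', g ≫ π, v', w', h'', ?_⟩
    exact HasProjForm.ext₂ _ o.mem (hPz.mono (by lia) (by lia)) (hZ.mono le_rfl (by lia))

end

/-! ### Non-negative functors and their stable functors -/

section

open DerivedCategory

variable {A : Type u₁} [Category.{v₁} A] [Abelian A] [HasDerivedCategory.{w₁} A]
  {B : Type u₂} [Category.{v₂} B] [Abelian B] [HasDerivedCategory.{w₂} B]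

/-- A functor between bounded derived categories is non-negative if it sends every object to an
object without cohomology in negative degrees, and every projective object to a bounded complex
of projective objects with zero terms in negative degrees. -/
structure IsNonnegative (F : Bounded A ⥤ Bounded B) : Prop where
  isZero_homology (X : A) (i : ℤ) (hi : i < 0) :
    IsZero ((homologyFunctor B i).obj (Bounded.ι.obj (F.obj ((toBounded A).obj X))))
  hasProjForm (P : A) (hP : Projective P) :
    ∃ n : ℤ, HasProjForm 0 n (Bounded.ι.obj (F.obj ((toBounded A).obj P)))

/-- A distinguished triangle `U ⟶ F(X) ⟶ M ⟶ U[1]` in the bounded derived category of `B`, where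
`M` is an object of `B`, and `U` is isomorphic to a complex `0 ⟶ U^1 ⟶ ⋯ ⟶ U^n ⟶ 0` of
projective objects, with `n > 0`. -/
structure StableTriangle (F : Bounded A ⥤ Bounded B) (X : A) where
  U : Bounded B
  M : B
  i : U ⟶ F.obj ((toBounded A).obj X)
  π : F.obj ((toBounded A).obj X) ⟶ (toBounded B).obj M
  μ : (toBounded B).obj M ⟶ U⟦(1 : ℤ)⟧
  distinguished : Triangle.mk i π μ ∈ distTriang (Bounded B)
  n : ℤ
  n_pos : 0 < n
  hasProjForm : HasProjForm 1 n (Bounded.ι.obj U)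

variable {F : Bounded A ⥤ Bounded B}

namespace StableTriangle

lemma hom_eq_zero {X : A} (ξ : StableTriangle F X) {N : B} (f : ξ.U ⟶ (toBounded B).obj N) :
    f = 0 := by
  apply Bounded.ι.map_injective
  rw [Functor.map_zero]
  exact ξ.hasProjForm.hom_single_eq_zero (j := 0) (by lia) (Y := N) (Bounded.ι.map f)

lemma hasProjForm_shift {X : A} (ξ : StableTriangle F X) :
    HasProjForm 0 (ξ.n - 1) (Bounded.ι.obj (ξ.U⟦(1 : ℤ)⟧)) :=
  (ξ.hasProjForm.shift 1 0 (ξ.n - 1) (by lia) (by lia)).of_iso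
    ((Bounded.ι.commShiftIso (1 : ℤ)).symm.app ξ.U)

lemma exists_lift {X : A} (ξ : StableTriangle F X) {N : B}
    (g : F.obj ((toBounded A).obj X) ⟶ (toBounded B).obj N) :
    ∃ b : ξ.M ⟶ N, ξ.π ≫ (toBounded B).map b = g := by
  obtain ⟨b, hb⟩ := Triangle.yoneda_exact₂ _ ξ.distinguished g (ξ.hom_eq_zero _)
  obtain ⟨b, rfl⟩ := (toBounded B).map_surjective b
  exact ⟨b, hb.symm⟩

lemma projRel_of_comp_eq {X : A} (ξ : StableTriangle F X) {N : B} (b b' : ξ.M ⟶ N)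
    (h : ξ.π ≫ (toBounded B).map b = ξ.π ≫ (toBounded B).map b') : projRel B b b' := by
  obtain ⟨s, hs⟩ := Triangle.yoneda_exact₃ _ ξ.distinguished ((toBounded B).map (b - b'))
    (by
      change ξ.π ≫ _ = 0
      rw [Functor.map_sub, Preadditive.comp_sub, h, sub_self])
  obtain ⟨P, hP, u, v, e⟩ := ξ.hasProjForm_shift.exists_factorization (Y := ξ.M) (Z := N)
    (Bounded.ι.map ξ.μ) (Bounded.ι.map s)
  refine ⟨P, hP, u, v, (singleFunctor B 0).map_injective ?_⟩
  exact (Bounded.ι.congr_map hs).trans ((Bounded.ι.map_comp ξ.μ s).trans e)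

/-- If `X` is projective, then so is `M`. -/
lemma projective_M (hF : IsNonnegative F) {X : A} (hX : Projective X) (ξ : StableTriangle F X) :
    Projective ξ.M where
  factors {E Y} f e _ := by
    obtain ⟨n, hn⟩ := hF.hasProjForm X hX
    have hS : (ShortComplex.mk (kernel.ι e) e (by simp)).ShortExact :=
      { exact := ShortComplex.exact_kernel e }
    have hT := hS.singleTriangle_distinguished
    have key : ∀ g : (singleFunctor B 0).obj ξ.M ⟶ ((singleFunctor B 0).obj (kernel e))⟦(1 : ℤ)⟧,
        g = 0 := by
      intro g
      let i := ((singleFunctors B).shiftIso 1 (-1) 0 (by lia)).app (kernel e)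
      have hT' := Bounded.ι.map_distinguished _ ξ.distinguished
      obtain ⟨s, hs⟩ := Triangle.yoneda_exact₃ _ hT' (g ≫ i.hom)
        (hn.hom_single_eq_zero (j := -1) (by lia) (Y := kernel e) _)
      have hs' : s = 0 := (ξ.hasProjForm.shift 1 0 (ξ.n - 1) (by lia) (by lia)).hom_single_eq_zero
        (j := -1) (by lia) (Y := kernel e) s
      rw [← cancel_mono i.hom, zero_comp]
      rw [hs', comp_zero] at hs
      exact hs
    obtain ⟨l, hl⟩ := Triangle.coyoneda_exact₃ _ hT ((singleFunctor B 0).map f) (key _)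
    obtain ⟨l, rfl⟩ := (singleFunctor B 0).map_surjective l
    exact ⟨l, (singleFunctor B 0).map_injective (by rw [Functor.map_comp]; exact hl.symm)⟩

end StableTriangle

/-- If `F` is non-negative, then a triangle as above exists for each object `X` of `A`. -/
theorem nonempty_stableTriangle [EnoughProjectives B] (hF : IsNonnegative F) (X : A) :
    Nonempty (StableTriangle F X) := by
  set Y := F.obj ((toBounded A).obj X) with hY
  have h₀ : (Bounded.ι.obj Y).IsGE 0 := (isGE_iff _ _).2 (fun i hi => hF.isZero_homology X i hi)
  obtain ⟨m, hm⟩ := Y.property.2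
  have hm' : (Bounded.ι.obj Y).IsLE m := hm
  have h₁ : (Bounded.ι.obj Y).IsLE m.toNat := TStructure.t.isLE_of_le _ m _ (by lia)
  obtain ⟨M, Z, π, v, w, h, hZ⟩ := exists_triangle m.toNat _ h₀ h₁
  obtain ⟨π', hπ⟩ := Bounded.ι.map_surjective (X := Y) (Y := (toBounded B).obj M) π
  obtain ⟨U, i, μ, hT⟩ := distinguished_cocone_triangle₁ π'
  have e : Bounded.ι.obj (U⟦(1 : ℤ)⟧) ≅ Z :=
    Triangle.π₃.mapIso (isoTriangleOfIso₁₂ _ _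
      (Bounded.ι.map_distinguished _ (rot_of_distTriang _ hT)) h (Iso.refl _) (Iso.refl _)
        ((Category.comp_id _).trans (hπ.trans (Category.id_comp _).symm)))
  have e' : (Bounded.ι.obj (U⟦(1 : ℤ)⟧))⟦(-1 : ℤ)⟧ ≅ Bounded.ι.obj U :=
    (Bounded.ι.commShiftIso (-1 : ℤ)).symm.app (U⟦(1 : ℤ)⟧) ≪≫
      Bounded.ι.mapIso ((shiftFunctorCompIsoId _ (1 : ℤ) (-1) (by lia)).app U)
  exact ⟨⟨U, M, i, π', μ, hT, m.toNat + 1, by lia,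
    ((hZ.of_iso e.symm).shift (-1) 1 (m.toNat + 1) (by lia) (by lia)).of_iso e'⟩⟩

variable (F) in
/-- The functor `A ⥤ StableCategory B` which induces the stable functor. It sends `X` to `M_X` and
`f : X ⟶ Y` to the class of a morphism `b : M_X ⟶ M_Y` such that `π_X ≫ b = F(f) ≫ π_Y`. -/
def preStableFunctor (ξ : ∀ X : A, StableTriangle F X) : A ⥤ StableCategory B where
  obj X := (toStable B).obj (ξ X).M
  map {X Y} f := (toStable B).map
    ((ξ X).exists_lift (F.map ((toBounded A).map f) ≫ (ξ Y).π)).choose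
  map_id X := by
    rw [← (toStable B).map_id, toStable_map_eq_iff]
    refine (ξ X).projRel_of_comp_eq _ _ ?_
    rw [((ξ X).exists_lift _).choose_spec]
    simp
  map_comp {X Y Z} f g := by
    rw [← (toStable B).map_comp, toStable_map_eq_iff]
    refine (ξ X).projRel_of_comp_eq _ _ ?_
    have hf := ((ξ X).exists_lift (F.map ((toBounded A).map f) ≫ (ξ Y).π)).choose_spec
    have hg := ((ξ Y).exists_lift (F.map ((toBounded A).map g) ≫ (ξ Z).π)).choose_spec
    rw [((ξ X).exists_lift _).choose_spec, (toBounded B).map_comp, ← Category.assoc, hf,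
      Category.assoc, hg]
    simp

/-- The image of `f` is represented by any `b` such that `π_X ≫ b = F(f) ≫ π_Y`. -/
lemma preStableFunctor_map_eq (ξ : ∀ X : A, StableTriangle F X) {X Y : A} (f : X ⟶ Y)
    (b : (ξ X).M ⟶ (ξ Y).M)
    (hb : (ξ X).π ≫ (toBounded B).map b = F.map ((toBounded A).map f) ≫ (ξ Y).π) :
    (preStableFunctor F ξ).map f = (toStable B).map b := by
  refine (toStable_map_eq_iff _ _).2 ((ξ X).projRel_of_comp_eq _ _ ?_)
  rw [((ξ X).exists_lift _).choose_spec, hb]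

/-- The stable functor of a non-negative triangle functor `F`, defined by fixing a triangle
`U_X ⟶ F(X) ⟶ M_X ⟶ U_X[1]` for each object `X` of `A`. It sends `X` to `M_X`, and the class of
`f : X ⟶ Y` to the class of any `b : M_X ⟶ M_Y` such that `π_X ≫ b = F(f) ≫ π_Y`. -/
def stableFunctor (F : Bounded A ⥤ Bounded B) [F.CommShift ℤ] [F.IsTriangulated] (hF : IsNonnegative F)
    (ξ : ∀ X : A, StableTriangle F X) : StableCategory A ⥤ StableCategory B :=
  CategoryTheory.Quotient.lift (projRel A) (preStableFunctor F ξ) (by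
    rintro X Y f g ⟨P, hP, u, v, e⟩
    obtain ⟨b, hb⟩ := (ξ X).exists_lift (F.map ((toBounded A).map f) ≫ (ξ Y).π)
    obtain ⟨c, hc⟩ := (ξ X).exists_lift (F.map ((toBounded A).map u) ≫ (ξ P).π)
    obtain ⟨d, hd⟩ := (ξ P).exists_lift (F.map ((toBounded A).map v) ≫ (ξ Y).π)
    rw [preStableFunctor_map_eq ξ f b hb, preStableFunctor_map_eq ξ g (b - c ≫ d) (by
      obtain rfl : g = f - u ≫ v := by rw [← e]; abel
      simp only [Functor.map_sub, Functor.map_comp, Preadditive.comp_sub, hb,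
        reassoc_of% hc, hd, Preadditive.sub_comp, Category.assoc])]
    refine (toStable_map_eq_iff _ _).2 ⟨(ξ P).M, (ξ P).projective_M hF hP, c, d, by abel⟩)

end

end StableCat

end

/-! Fix a presentation `0 → ΩX → P → X → 0` and let `δ : M_X ⟶ Ω(M_X)⟦1⟧` be the connecting morphism
of a presentation `0 → Ω(M_X) → Q → M_X → 0`. Let `W` be the homotopy fibre of `F(X) ⟶ M_X ⟶
Ω(M_X)⟦1⟧`. By the octahedral axiom `W` is an extension of `Q` by `U_X`, hence a bounded complex of
projectives in degrees `≥ 0` (`hasProjForm_fiber`).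

Since `F(P)` has no terms in degree `-1`, it has no nonzero morphism to `Ω(M_X)⟦1⟧`, so `F(P) ⟶
F(X)` lifts to `W`. The lift yields a triangle `F(ΩX) ⟶ Ω(M_X) ⊞ F(P) ⟶ W`
(`exists_distinguished_of_lift`). Composing its first morphism with `F(P) ⟶ M_P` gives `F(ΩX) ⟶
Ω(M_X) ⊞ M_P`, whose cone is an extension of `U_P⟦1⟧` by `W`, again projective in degrees `≥ 0`.
This is therefore a stable triangle for `ΩX`. Such triangles are unique up to stable isomorphism and
`M_P` is projective, so `M_{ΩX}` and `Ω(M_X)` are stably isomorphic (`exists_syzygy_comparison`).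

For naturality, the comparison is built compatible with the connecting morphisms `F(X) ⟶ F(ΩX)⟦1⟧`
and `δ`. This compatibility determines it in the stable category, because an ambiguity factors
through the projective object `M_P` (`projRel_of_mapδ_comp_eq`). Both composites in the naturality
square satisfy the same compatibility. -/

noncomputable section

namespace StableCat

/-! ### An octahedron for morphisms out of a biproduct. -/

section

variable {C : Type u₁} [Category.{v₁} C] [Preadditive C] [HasZeroObject C] [HasShift C ℤ]
  [∀ n : ℤ, (shiftFunctor C n).Additive] [Pretriangulated C] [IsTriangulated C]

/-- The cone of `biprod.desc k l : K ⊞ Y ⟶ W` is a cone of the composition of `l` with the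
morphism from `W` to the cone of `k`. -/
lemma exists_distinguished_of_biprod_desc {K Y W V Z : C} [HasBinaryBiproduct K Y]
    {k : K ⟶ W} {v : W ⟶ V} {w : V ⟶ K⟦(1 : ℤ)⟧} (h : Triangle.mk k v w ∈ distTriang C)
    {l : Y ⟶ W} {b : W ⟶ Z} {c : Z ⟶ (K ⊞ Y)⟦(1 : ℤ)⟧}
    (h' : Triangle.mk (biprod.desc k l) b c ∈ distTriang C) :
    ∃ (m : V ⟶ Z) (t : Z ⟶ Y⟦(1 : ℤ)⟧), Triangle.mk (l ≫ v) m t ∈ distTriang C ∧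
      v ≫ m = b ∧ m ≫ c = w ≫ biprod.inl⟦1⟧' := by
  -- The octahedron on `inl ≫ desc k l = k`; the three cones are `Y`, `Z` and `V`.
  have o := Triangulated.someOctahedron (u₁₂ := (biprod.inl : K ⟶ K ⊞ Y)) (by simp)
    (binaryBiproductTriangle_distinguished K Y) h' h
  have e : o.m₁ = l ≫ v := by
    have := biprod.inr ≫= o.comm₁
    simpa using this
  exact ⟨o.m₃, _, e ▸ o.mem, o.comm₃, o.comm₄.symm⟩

end

/-! ### Isomorphisms in the stable category. -/

section

variable {C : Type u₁} [Category.{v₁} C] [Abelian C]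

lemma projRel_comp_zero {X P Y : C} [hP : Projective P] (f : X ⟶ P) (g : P ⟶ Y) :
    projRel C (f ≫ g) 0 :=
  ⟨P, hP, f, g, by simp⟩

lemma isIso_toStable_map_of_projRel {X Y : C} (f : X ⟶ Y) (g : Y ⟶ X)
    (h : projRel C (f ≫ g) (𝟙 X)) (h' : projRel C (g ≫ f) (𝟙 Y)) :
    IsIso ((toStable C).map f) :=
  ⟨(toStable C).map g, by
    rw [← Functor.map_comp, ← Functor.map_comp, ← (toStable C).map_id, ← (toStable C).map_id]
    exact ⟨(toStable_map_eq_iff _ _).2 h, (toStable_map_eq_iff _ _).2 h'⟩⟩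

/-- The inverse is `inl`: the error `fst ≫ inl - 𝟙 = -(snd ≫ inr)` passes through `P`. -/
lemma isIso_toStable_map_biprod_fst (X P : C) [hP : Projective P] :
    IsIso ((toStable C).map (biprod.fst : X ⊞ P ⟶ X)) :=
  isIso_toStable_map_of_projRel _ biprod.inl
    ⟨P, hP, biprod.snd, -biprod.inr, by
      rw [← biprod.total, Preadditive.comp_neg]; abel⟩
    (by rw [biprod.inl_fst]; exact projRel.congruence.equivalence.refl _)

end

/-! ### Connecting morphisms and complexes of projectives in the bounded derived category. -/

section

open DerivedCategory

variable {C : Type u₁} [Category.{v₁} C] [Abelian C] [HasDerivedCategory.{w₁} C]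

/-- The connecting morphism in the derived category of a short exact sequence, as a morphism
between images of objects of the bounded derived category. -/
def singleδBounded {S : ShortComplex C} (hS : S.ShortExact) :
    Bounded.ι.obj ((toBounded C).obj S.X₃) ⟶ (Bounded.ι.obj ((toBounded C).obj S.X₁))⟦(1 : ℤ)⟧ :=
  hS.singleδ

/-- The connecting morphism in the bounded derived category of a short exact sequence. -/
def boundedδ {S : ShortComplex C} (hS : S.ShortExact) :
    (toBounded C).obj S.X₃ ⟶ ((toBounded C).obj S.X₁)⟦(1 : ℤ)⟧ :=
  Bounded.ι.preimage (singleδBounded hS ≫ (Bounded.ι.commShiftIso (1 : ℤ)).inv.app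
    ((toBounded C).obj S.X₁))

lemma ι_map_boundedδ {S : ShortComplex C} (hS : S.ShortExact) :
    Bounded.ι.map (boundedδ hS) = singleδBounded hS ≫
      (Bounded.ι.commShiftIso (1 : ℤ)).inv.app ((toBounded C).obj S.X₁) :=
  Bounded.ι.map_preimage _

/-- The inclusion `Bounded.ι` reflects distinguished triangles, and up to the shift isomorphism the
image is the usual triangle of a short exact sequence. -/
lemma bounded_distinguished {S : ShortComplex C} (hS : S.ShortExact) :
    Triangle.mk ((toBounded C).map S.f) ((toBounded C).map S.g) (boundedδ hS) ∈
      distTriang (Bounded C) := by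
  rw [← Bounded.ι.map_distinguished_iff]
  have e : Bounded.ι.map (boundedδ hS) ≫ (Bounded.ι.commShiftIso (1 : ℤ)).hom.app _ =
      singleδBounded hS := by
    rw [ι_map_boundedδ, Category.assoc, Iso.inv_hom_id_app]
    exact Category.comp_id _
  change Triangle.mk (Bounded.ι.map ((toBounded C).map S.f)) (Bounded.ι.map ((toBounded C).map S.g))
    (Bounded.ι.map (boundedδ hS) ≫ (Bounded.ι.commShiftIso (1 : ℤ)).hom.app _) ∈ distTriang _
  rw [e]
  exact hS.singleTriangle_distinguished

lemma singleδBounded_naturality {S₁ S₂ : ShortComplex C} (h₁ : S₁.ShortExact)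
    (h₂ : S₂.ShortExact) (f : S₁ ⟶ S₂) :
    Bounded.ι.map ((toBounded C).map f.τ₃) ≫ singleδBounded h₂ =
      singleδBounded h₁ ≫ (Bounded.ι.map ((toBounded C).map f.τ₁))⟦1⟧' :=
  (ShortComplex.ShortExact.singleTriangle.map h₁ h₂ f).comm₃.symm

lemma boundedδ_naturality {S₁ S₂ : ShortComplex C} (h₁ : S₁.ShortExact) (h₂ : S₂.ShortExact)
    (f : S₁ ⟶ S₂) :
    (toBounded C).map f.τ₃ ≫ boundedδ h₂ = boundedδ h₁ ≫ ((toBounded C).map f.τ₁)⟦1⟧' := by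
  apply Bounded.ι.map_injective
  rw [Functor.map_comp, Functor.map_comp, ι_map_boundedδ, ι_map_boundedδ, Category.assoc,
    ← Category.assoc, singleδBounded_naturality h₁ h₂, Category.assoc,
    Bounded.ι.commShiftIso_inv_naturality]

lemma HasProjForm.of_shift_one {a b a' b' : ℤ} {X : Bounded C}
    (h : HasProjForm a b (Bounded.ι.obj (X⟦(1 : ℤ)⟧))) (ha : a' = a + 1) (hb : b' = b + 1) :
    HasProjForm a' b' (Bounded.ι.obj X) :=
  (h.shift (-1) a' b' (by lia) (by lia)).of_iso
    ((Bounded.ι.commShiftIso (-1 : ℤ)).symm.app (X⟦(1 : ℤ)⟧) ≪≫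
      Bounded.ι.mapIso ((shiftFunctorCompIsoId _ (1 : ℤ) (-1) (by lia)).app X))

lemma HasProjForm.bounded_ext₂ {a b : ℤ} {X Y Z : Bounded C} {f : X ⟶ Y} {g : Y ⟶ Z}
    {h : Z ⟶ X⟦(1 : ℤ)⟧} (hT : Triangle.mk f g h ∈ distTriang _)
    (h₁ : HasProjForm a b (Bounded.ι.obj X)) (h₃ : HasProjForm a b (Bounded.ι.obj Z)) :
    HasProjForm a b (Bounded.ι.obj Y) :=
  HasProjForm.ext₂ _ (Bounded.ι.map_distinguished _ hT) h₁ h₃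

/-- The target is concentrated in degree `-1`, where the complex of projectives has no term. This is
the obstruction to lifting `F(P) ⟶ F(X)` to the fibre `W`. -/
lemma HasProjForm.hom_shift_eq_zero {b : ℤ} {X : Bounded C} (h : HasProjForm 0 b (Bounded.ι.obj X))
    {Y : C} (f : X ⟶ ((toBounded C).obj Y)⟦(1 : ℤ)⟧) : f = 0 := by
  let i : Bounded.ι.obj (((toBounded C).obj Y)⟦(1 : ℤ)⟧) ≅ (singleFunctor C (-1)).obj Y :=
    (Bounded.ι.commShiftIso (1 : ℤ)).app _ ≪≫
      ((singleFunctors C).shiftIso 1 (-1) 0 (by lia)).app Y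
  apply Bounded.ι.map_injective
  rw [← cancel_mono i.hom, Functor.map_zero, zero_comp]
  exact h.hom_single_eq_zero (j := -1) (by lia) (Y := Y) _

end

/-! ### Factorization through the first morphism of a triangle. -/

section

variable {C : Type u₁} [Category.{v₁} C] [Preadditive C] [HasZeroObject C] [HasShift C ℤ]
  [∀ n : ℤ, (shiftFunctor C n).Additive] [Pretriangulated C]

/-- Exactness of `Hom(-, N⟦1⟧)` on the rotated triangle, followed by desuspension. -/
lemma exists_sub_eq_comp {X Y Z N : C} {f : X ⟶ Y} {g : Y ⟶ Z} {h : Z ⟶ X⟦(1 : ℤ)⟧}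
    (hT : Triangle.mk f g h ∈ distTriang C) (k k' : X ⟶ N) (hk : h ≫ k⟦1⟧' = h ≫ k'⟦1⟧') :
    ∃ t : Y ⟶ N, k - k' = f ≫ t := by
  obtain ⟨t, ht⟩ : ∃ t : Y⟦(1 : ℤ)⟧ ⟶ N⟦(1 : ℤ)⟧, (k - k')⟦(1 : ℤ)⟧' = (-f⟦(1 : ℤ)⟧') ≫ t :=
    Triangle.yoneda_exact₃ _ (rot_of_distTriang _ hT) ((k - k')⟦(1 : ℤ)⟧') (by
      change h ≫ (k - k')⟦(1 : ℤ)⟧' = 0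
      rw [Functor.map_sub, Preadditive.comp_sub, hk, sub_self])
  obtain ⟨t, rfl⟩ := (shiftFunctor C (1 : ℤ)).map_surjective t
  -- The sign comes from the rotated triangle, whose third morphism is `-f⟦1⟧'`.
  refine ⟨-t, (shiftFunctor C (1 : ℤ)).map_injective ?_⟩
  rw [ht, Functor.map_comp, Functor.map_neg, Preadditive.neg_comp, Preadditive.comp_neg]

end

/-! ### Recognition and uniqueness of stable triangles; connecting morphisms after applying `F`. -/

section

open DerivedCategory

variable {A : Type u₁} [Category.{v₁} A] [Abelian A] [HasDerivedCategory.{w₁} A]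
  {B : Type u₂} [Category.{v₂} B] [Abelian B] [HasDerivedCategory.{w₂} B]
  {F : Bounded A ⥤ Bounded B}

/-- If the cone of a morphism `F(X) ⟶ M` is a complex of projective objects in nonnegative
degrees, then this morphism is part of a stable triangle. -/
def StableTriangle.ofCone {X : A} {M : B} {Z : Bounded B}
    {π : F.obj ((toBounded A).obj X) ⟶ (toBounded B).obj M} {v : (toBounded B).obj M ⟶ Z}
    {w : Z ⟶ (F.obj ((toBounded A).obj X))⟦(1 : ℤ)⟧} (h : Triangle.mk π v w ∈ distTriang _)
    {n : ℤ} (hZ : HasProjForm 0 n (Bounded.ι.obj Z)) : StableTriangle F X :=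
  have H := distinguished_cocone_triangle₁ π
  have e : Bounded.ι.obj (H.choose⟦(1 : ℤ)⟧) ≅ Bounded.ι.obj Z :=
    Bounded.ι.mapIso (Triangle.π₃.mapIso (isoTriangleOfIso₁₂ _ _
      (rot_of_distTriang _ H.choose_spec.choose_spec.choose_spec) h (Iso.refl _) (Iso.refl _)
        ((Category.comp_id _).trans (Category.id_comp _).symm)))
  { U := H.choose
    M := M
    i := H.choose_spec.choose
    π := π
    μ := H.choose_spec.choose_spec.choose
    distinguished := H.choose_spec.choose_spec.choose_spec
    -- The `+ 1` accounts for `U` being `Z` shifted by `-1`; the `max` keeps the bound positive when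
    -- `n` is negative.
    n := max n 0 + 1
    n_pos := by lia
    hasProjForm := ((hZ.of_iso e.symm).of_shift_one rfl rfl).mono (by lia) (by lia) }

/-- The objects `M` of two stable triangles for `X` are isomorphic in the stable category. -/
lemma StableTriangle.isIso_toStable_map {X : A} (ξ ξ' : StableTriangle F X) (b : ξ.M ⟶ ξ'.M)
    (hb : ξ.π ≫ (toBounded B).map b = ξ'.π) : IsIso ((toStable B).map b) := by
  obtain ⟨c, hc⟩ := ξ'.exists_lift ξ.π
  refine isIso_toStable_map_of_projRel b c (ξ.projRel_of_comp_eq _ _ ?_)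
    (ξ'.projRel_of_comp_eq _ _ ?_)
  · rw [Functor.map_comp, reassoc_of% hb, hc, (toBounded B).map_id, Category.comp_id]
  · rw [Functor.map_comp, reassoc_of% hc, hb, (toBounded B).map_id, Category.comp_id]

section

variable [F.CommShift ℤ]

variable (F) in
/-- The connecting morphism of the image by `F` of the triangle of a short exact sequence. -/
def mapδ {S : ShortComplex A} (hS : S.ShortExact) :
    F.obj ((toBounded A).obj S.X₃) ⟶ (F.obj ((toBounded A).obj S.X₁))⟦(1 : ℤ)⟧ :=
  F.map (boundedδ hS) ≫ (F.commShiftIso (1 : ℤ)).hom.app _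

lemma map_bounded_distinguished [F.IsTriangulated] {S : ShortComplex A} (hS : S.ShortExact) :
    Triangle.mk (F.map ((toBounded A).map S.f)) (F.map ((toBounded A).map S.g)) (mapδ F hS) ∈
      distTriang (Bounded B) :=
  F.map_distinguished _ (bounded_distinguished hS)

lemma mapδ_naturality {S₁ S₂ : ShortComplex A} (h₁ : S₁.ShortExact) (h₂ : S₂.ShortExact)
    (f : S₁ ⟶ S₂) :
    F.map ((toBounded A).map f.τ₃) ≫ mapδ F h₂ =
      mapδ F h₁ ≫ (F.map ((toBounded A).map f.τ₁))⟦1⟧' := by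
  rw [mapδ, mapδ, Category.assoc, ← F.commShiftIso_hom_naturality, ← Functor.map_comp_assoc,
    boundedδ_naturality h₁ h₂, Functor.map_comp_assoc]

variable [F.IsTriangulated]

/-- Morphisms from `M_{X₁}` are determined in the stable category by their compositions with the
connecting morphism `F(X₃) ⟶ F(X₁)⟦1⟧`, if `X₂` is projective. -/
lemma projRel_of_mapδ_comp_eq (hF : IsNonnegative F) {S : ShortComplex A} (hS : S.ShortExact)
    (hP : Projective S.X₂) (ξ₁ : StableTriangle F S.X₁) (ξ₂ : StableTriangle F S.X₂) {N : B}
    (g g' : ξ₁.M ⟶ N)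
    (h : mapδ F hS ≫ (ξ₁.π ≫ (toBounded B).map g)⟦1⟧' =
      mapδ F hS ≫ (ξ₁.π ≫ (toBounded B).map g')⟦1⟧') : projRel B g g' := by
  -- The difference on `F(X₁)` factors through `F(X₂)`. Lifting both factors along `π` makes `g -
  -- g'` stably equal to a morphism through the projective object `M_{X₂}`.
  obtain ⟨t, ht⟩ := exists_sub_eq_comp (map_bounded_distinguished hS) _ _ h
  obtain ⟨c, rfl⟩ := ξ₂.exists_lift t
  obtain ⟨e, he⟩ := ξ₁.exists_lift (F.map ((toBounded A).map S.f) ≫ ξ₂.π)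
  have := ξ₂.projective_M hF hP
  have h₁ : projRel B (g - g') (e ≫ c) := ξ₁.projRel_of_comp_eq _ _ (by
    rw [Functor.map_sub, Preadditive.comp_sub, ht, Functor.map_comp, reassoc_of% he])
  obtain ⟨P, hP, a, b, hab⟩ := projRel.congruence.equivalence.trans h₁ (projRel_comp_zero _ _)
  exact ⟨P, hP, a, b, by rw [← hab, sub_zero]⟩

end

end

/-! ### The triangle obtained from a lift to the middle of another triangle. -/

section

variable {C : Type u₁} [Category.{v₁} C] [Preadditive C] [HasZeroObject C] [HasShift C ℤ]
  [∀ n : ℤ, (shiftFunctor C n).Additive] [Pretriangulated C]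

lemma distinguished_rotate {X Y Z : C} {f : X ⟶ Y} {g : Y ⟶ Z} {h : Z ⟶ X⟦(1 : ℤ)⟧}
    (hT : Triangle.mk f g h ∈ distTriang C) : Triangle.mk g h (-f⟦(1 : ℤ)⟧') ∈ distTriang C :=
  rot_of_distTriang _ hT

lemma exists_iso_cone {X Y Z Z' : C} {f : X ⟶ Y} {g : Y ⟶ Z} {h : Z ⟶ X⟦(1 : ℤ)⟧}
    (hT : Triangle.mk f g h ∈ distTriang C) {g' : Y ⟶ Z'} {h' : Z' ⟶ X⟦(1 : ℤ)⟧}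
    (hT' : Triangle.mk f g' h' ∈ distTriang C) : ∃ e : Z ≅ Z', g ≫ e.hom = g' := by
  let e := isoTriangleOfIso₁₂ _ _ hT hT' (Iso.refl _) (Iso.refl _)
    ((Category.comp_id _).trans (Category.id_comp _).symm)
  exact ⟨Triangle.π₃.mapIso e, e.hom.comm₂.trans (Category.id_comp _)⟩

variable [IsTriangulated C]

/-- Given distinguished triangles `X ⟶ Y ⟶ V ⟶ X⟦1⟧` and `K ⟶ W ⟶ V ⟶ K⟦1⟧`, and a lift of
`Y ⟶ V` to `W`, there is a distinguished triangle `X ⟶ K ⊞ Y ⟶ W ⟶ X⟦1⟧` which is compatible with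
the connecting morphisms. -/
lemma exists_distinguished_of_lift {X Y V K W : C} [HasBinaryBiproduct K Y]
    {i : X ⟶ Y} {p : Y ⟶ V} {d : V ⟶ X⟦(1 : ℤ)⟧} (h : Triangle.mk i p d ∈ distTriang C)
    {k : K ⟶ W} {v : W ⟶ V} {w : V ⟶ K⟦(1 : ℤ)⟧} (h' : Triangle.mk k v w ∈ distTriang C)
    {l : Y ⟶ W} (hl : l ≫ v = p) :
    ∃ (s : X ⟶ K ⊞ Y) (b : K ⊞ Y ⟶ W) (c : W ⟶ X⟦(1 : ℤ)⟧),
      Triangle.mk s b c ∈ distTriang C ∧ d ≫ (s ≫ biprod.fst)⟦1⟧' = w := by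
  -- The fibre `X'` of `desc k l` is identified with `X` afterwards: by the octahedron, `X'⟦1⟧` and
  -- `X⟦1⟧` are both cones of `p`.
  obtain ⟨X', f, g, hT⟩ := distinguished_cocone_triangle₁ (biprod.desc k l)
  obtain ⟨m, t, hm, -, hmw⟩ := exists_distinguished_of_biprod_desc h' (distinguished_rotate hT)
  rw [hl] at hm
  obtain ⟨e, he⟩ := exists_iso_cone hm (distinguished_rotate h)
  obtain ⟨e', rfl⟩ : ∃ e' : X' ≅ X, (shiftFunctor C (1 : ℤ)).mapIso e' = e :=
    ⟨(shiftFunctor C (1 : ℤ)).preimageIso e, by ext; simp⟩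
  -- Rotation turns `f` into `-f⟦1⟧'`, so `s` must carry a sign for `d` to be sent to `w` exactly.
  -- Negating `b` too keeps the triangle distinguished, through the automorphism `-𝟙` of the middle
  -- term.
  let ν : K ⊞ Y ≅ K ⊞ Y := ⟨-𝟙 _, -𝟙 _, by simp, by simp⟩
  refine ⟨-(e'.inv ≫ f), -biprod.desc k l, g ≫ e'.hom⟦1⟧',
    isomorphic_distinguished _ hT _ (Triangle.isoMk _ _ e'.symm ν (Iso.refl _) ?_ ?_ ?_), ?_⟩
  · change (-(e'.inv ≫ f)) ≫ (-𝟙 (K ⊞ Y)) = e'.inv ≫ f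
    simp
  · change (-biprod.desc k l) ≫ 𝟙 _ = (-𝟙 (K ⊞ Y)) ≫ biprod.desc k l
    simp
  · change (g ≫ e'.hom⟦1⟧') ≫ e'.inv⟦1⟧' = 𝟙 _ ≫ g
    simp [← Functor.map_comp]
  · rw [← he, Functor.mapIso_hom, Category.assoc, ← Functor.map_comp, Preadditive.neg_comp,
      Preadditive.comp_neg, Category.assoc, Iso.hom_inv_id_assoc, ← Preadditive.neg_comp,
      Functor.map_comp, Functor.map_neg, ← Category.assoc, hmw, Category.assoc,
      ← Functor.map_comp, biprod.inl_fst, (shiftFunctor C (1 : ℤ)).map_id, Category.comp_id]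

end

/-! ### The short exact sequence of a syzygy. -/

section

variable {C : Type u₁} [Category.{v₁} C] [Abelian C]

/-- The short exact sequence `0 ⟶ Ω(X) ⟶ P ⟶ X ⟶ 0` of a projective presentation. -/
abbrev syzygyShortComplex {X : C} (P : ProjectivePresentation X) : ShortComplex C :=
  ShortComplex.mk (kernel.ι P.f) P.f (kernel.condition _)

lemma syzygyShortComplex_shortExact {X : C} (P : ProjectivePresentation X) :
    (syzygyShortComplex P).ShortExact where
  exact := ShortComplex.exact_kernel P.f

end

/-! ### The comparison between `M_{ΩX}` and `Ω(M_X)`. -/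

section

open DerivedCategory

variable {A : Type u₁} [Category.{v₁} A] [Abelian A] [HasDerivedCategory.{w₁} A]
  {B : Type u₂} [Category.{v₂} B] [Abelian B] [HasDerivedCategory.{w₂} B]
  {F : Bounded A ⥤ Bounded B}

namespace StableTriangle

/-- The cone of the morphism `N ⊞ F(X) ⟶ N ⊞ M` is the cone of `F(X) ⟶ M`. -/
lemma hasProjForm_cone_biprod_desc {X : A} (ξ : StableTriangle F X) (N : B) {Z : Bounded B}
    {b : (toBounded B).obj (N ⊞ ξ.M) ⟶ Z} {c : Z ⟶ _}
    (h : Triangle.mk (biprod.desc ((toBounded B).map biprod.inl)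
      (ξ.π ≫ (toBounded B).map biprod.inr)) b c ∈ distTriang _) :
    HasProjForm 0 (ξ.n - 1) (Bounded.ι.obj Z) := by
  have hS := (ShortComplex.Splitting.ofHasBinaryBiproduct N ξ.M).shortExact
  -- The split sequence `N ⟶ N ⊞ M ⟶ M` plays the role of `K ⟶ W ⟶ V`, so the summand `N` cancels
  -- and `Z` is a cone of `π`, that is `U⟦1⟧`.
  obtain ⟨m, t, hm, -, -⟩ := exists_distinguished_of_biprod_desc (bounded_distinguished hS) h
  rw [Category.assoc, ← Functor.map_comp, biprod.inr_snd, (toBounded B).map_id,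
    Category.comp_id] at hm
  obtain ⟨e, -⟩ := exists_iso_cone (distinguished_rotate ξ.distinguished) hm
  exact ξ.hasProjForm_shift.of_iso (Bounded.ι.mapIso e)

/-- The homotopy fiber of `F(X) ⟶ M ⟶ Ω(M)⟦1⟧` is a complex of projective objects in
nonnegative degrees. -/
lemma hasProjForm_fiber {X : A} (ξ : StableTriangle F X) (Q : ProjectivePresentation ξ.M)
    {W : Bounded B} {k : (toBounded B).obj (kernel Q.f) ⟶ W}
    {v : W ⟶ F.obj ((toBounded A).obj X)}
    (h : Triangle.mk k v (ξ.π ≫ boundedδ (syzygyShortComplex_shortExact Q)) ∈ distTriang _) :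
    HasProjForm 0 ξ.n (Bounded.ι.obj W) := by
  -- The fibres of `π`, of the connecting morphism and of their composite are `U`, `Q.p` and `W`;
  -- the octahedron gives a triangle `U ⟶ W ⟶ Q.p`.
  have o := Triangulated.someOctahedron' rfl ξ.distinguished
    (rot_of_distTriang _ (bounded_distinguished (syzygyShortComplex_shortExact Q)))
    (rot_of_distTriang _ h)
  exact HasProjForm.bounded_ext₂ o.mem (ξ.hasProjForm.mono (by lia) (by lia))
    ((hasProjForm_single Q.p 0).mono le_rfl ξ.n_pos.le)

end StableTriangle

/-- The comparison between the syzygies: if `P` is a projective presentation of `X`, then the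
connecting morphism of `F(Ω(X)) ⟶ F(P) ⟶ F(X)` is compatible, via a stable isomorphism
`M_{Ω(X)} ⟶ Ω(M_X)`, with the connecting morphism of a projective presentation of `M_X`. -/
lemma exists_syzygy_comparison [F.CommShift ℤ] [F.IsTriangulated] (hF : IsNonnegative F) {X : A}
    (P : ProjectivePresentation X) (ξ₁ : StableTriangle F (kernel P.f))
    (ξ₂ : StableTriangle F P.p) (ξ₃ : StableTriangle F X) (Q : ProjectivePresentation ξ₃.M) :
    ∃ β : ξ₁.M ⟶ kernel Q.f, IsIso ((toStable B).map β) ∧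
      mapδ F (syzygyShortComplex_shortExact P) ≫ (ξ₁.π ≫ (toBounded B).map β)⟦1⟧' =
        ξ₃.π ≫ boundedδ (syzygyShortComplex_shortExact Q) := by
  obtain ⟨W, k, v, hW⟩ := distinguished_cocone_triangle₂
    (ξ₃.π ≫ boundedδ (syzygyShortComplex_shortExact Q))
  have hW' := ξ₃.hasProjForm_fiber Q hW
  obtain ⟨n, hn⟩ := hF.hasProjForm P.p inferInstance
  obtain ⟨l, hl⟩ : ∃ l : F.obj ((toBounded A).obj P.p) ⟶ W, F.map ((toBounded A).map P.f) = l ≫ v :=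
    Triangle.coyoneda_exact₃ _ hW (F.map ((toBounded A).map P.f))
      (hn.hom_shift_eq_zero (Y := kernel Q.f) _)
  obtain ⟨s, b, c, hs, hsw⟩ := exists_distinguished_of_lift
    (map_bounded_distinguished (syzygyShortComplex_shortExact P)) hW hl.symm
  let φ : (toBounded B).obj (kernel Q.f) ⊞ F.obj ((toBounded A).obj P.p) ⟶
      (toBounded B).obj (kernel Q.f ⊞ ξ₂.M) :=
    biprod.desc ((toBounded B).map biprod.inl) (ξ₂.π ≫ (toBounded B).map biprod.inr)
  obtain ⟨Z, v', w', h'⟩ := distinguished_cocone_triangle φ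
  obtain ⟨Z', v'', w'', h''⟩ := distinguished_cocone_triangle (s ≫ φ)
  -- The cones of `s`, `φ` and `s ≫ φ` form a triangle `W ⟶ Z' ⟶ Z`, which makes `s ≫ φ` a
  -- legitimate choice of `π` for the syzygy.
  have o := Triangulated.someOctahedron rfl hs h' h''
  have hZ' : HasProjForm 0 (max ξ₃.n (ξ₂.n - 1)) (Bounded.ι.obj Z') :=
    HasProjForm.bounded_ext₂ o.mem (hW'.mono le_rfl (by lia))
      ((ξ₂.hasProjForm_cone_biprod_desc _ h').mono le_rfl (by lia))
  let ξ' : StableTriangle F (kernel P.f) := .ofCone h'' hZ'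
  obtain ⟨β, hβ⟩ : ∃ β : ξ₁.M ⟶ kernel Q.f ⊞ ξ₂.M, ξ₁.π ≫ (toBounded B).map β = s ≫ φ :=
    ξ₁.exists_lift (s ≫ φ)
  have : IsIso ((toStable B).map β) := ξ₁.isIso_toStable_map ξ' β hβ
  have := ξ₂.projective_M hF inferInstance
  have := isIso_toStable_map_biprod_fst (kernel Q.f) ξ₂.M
  have hφ : φ ≫ (toBounded B).map biprod.fst = biprod.fst := by
    refine biprod.hom_ext' _ _ ?_ ?_
    · rw [biprod.inl_desc_assoc, biprod.inl_fst, ← Functor.map_comp, biprod.inl_fst,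
        (toBounded B).map_id]
    · rw [biprod.inr_desc_assoc, Category.assoc, biprod.inr_fst, ← Functor.map_comp,
        biprod.inr_fst, Functor.map_zero, comp_zero]
  -- Dropping the projective summand `M_P` is a stable isomorphism. As `φ` is the identity on
  -- `kernel Q.f`, the composite with `π` becomes `s ≫ biprod.fst`, to which `hsw` applies.
  refine ⟨β ≫ biprod.fst, ?_, ?_⟩
  · rw [Functor.map_comp]
    infer_instance
  · rw [(toBounded B).map_comp, reassoc_of% hβ, hφ]
    exact hsw

end

/-! ### Naturality of the comparison. -/

section

variable {C : Type u₁} [Category.{v₁} C] [Abelian C] (p : ∀ X : C, ProjectivePresentation X)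

/-- The morphism of short exact sequences which extends `syzygyMap`. -/
def syzygyShortComplexMap {X Y : C} (f : X ⟶ Y) :
    syzygyShortComplex (p X) ⟶ syzygyShortComplex (p Y) where
  τ₁ := syzygyMap p f
  τ₂ := Projective.factorThru ((p X).f ≫ f) (p Y).f
  τ₃ := f
  comm₁₂ := by simp [syzygyMap]
  comm₂₃ := by simp

end

section

open DerivedCategory

variable {A : Type u₁} [Category.{v₁} A] [Abelian A] [HasDerivedCategory.{w₁} A]
  {B : Type u₂} [Category.{v₂} B] [Abelian B] [HasDerivedCategory.{w₂} B]
  {F : Bounded A ⥤ Bounded B} [F.CommShift ℤ] [F.IsTriangulated]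

/-- The comparison morphisms `M_{Ω(X)} ⟶ Ω(M_X)` are natural in the stable category. -/
lemma syzygy_comparison_naturality (hF : IsNonnegative F) (ξ : ∀ X : A, StableTriangle F X)
    (p : ∀ X : A, ProjectivePresentation X) (q : ∀ Y : B, ProjectivePresentation Y)
    {X Y : A} (f : X ⟶ Y) (βX : (ξ (syzygyObj p X)).M ⟶ syzygyObj q (ξ X).M)
    (βY : (ξ (syzygyObj p Y)).M ⟶ syzygyObj q (ξ Y).M)
    (hX : mapδ F (syzygyShortComplex_shortExact (p X)) ≫ ((ξ _).π ≫ (toBounded B).map βX)⟦1⟧' =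
      (ξ X).π ≫ boundedδ (syzygyShortComplex_shortExact (q (ξ X).M)))
    (hY : mapδ F (syzygyShortComplex_shortExact (p Y)) ≫ ((ξ _).π ≫ (toBounded B).map βY)⟦1⟧' =
      (ξ Y).π ≫ boundedδ (syzygyShortComplex_shortExact (q (ξ Y).M)))
    (b : (ξ X).M ⟶ (ξ Y).M)
    (hb : (ξ X).π ≫ (toBounded B).map b = F.map ((toBounded A).map f) ≫ (ξ Y).π)
    (c : (ξ (syzygyObj p X)).M ⟶ (ξ (syzygyObj p Y)).M)
    (hc : (ξ _).π ≫ (toBounded B).map c = F.map ((toBounded A).map (syzygyMap p f)) ≫ (ξ _).π) :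
    projRel B (c ≫ βY) (βX ≫ syzygyMap q b) := by
  have h₁ := mapδ_naturality (F := F) (syzygyShortComplex_shortExact (p X))
    (syzygyShortComplex_shortExact (p Y)) (syzygyShortComplexMap p f)
  have h₂ := boundedδ_naturality (syzygyShortComplex_shortExact (q (ξ X).M))
    (syzygyShortComplex_shortExact (q (ξ Y).M)) (syzygyShortComplexMap q b)
  dsimp only [syzygyShortComplexMap] at h₁ h₂
  refine projRel_of_mapδ_comp_eq hF (syzygyShortComplex_shortExact (p X)) (p X).projective
    (ξ _) (ξ _) _ _ ?_
  have e₁ : (ξ (syzygyObj p X)).π ≫ (toBounded B).map (c ≫ βY) =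
      F.map ((toBounded A).map (syzygyMap p f)) ≫ (ξ _).π ≫ (toBounded B).map βY := by
    rw [Functor.map_comp, reassoc_of% hc]
  have e₂ : (ξ (syzygyObj p X)).π ≫ (toBounded B).map (βX ≫ syzygyMap q b) =
      ((ξ _).π ≫ (toBounded B).map βX) ≫ (toBounded B).map (syzygyMap q b) := by
    rw [Functor.map_comp, Category.assoc]
  -- Both sides equal `F(f)` followed by `π_Y` and the connecting morphism of `M_Y`.
  calc _ = F.map ((toBounded A).map f) ≫ (ξ Y).π ≫ boundedδ (syzygyShortComplex_shortExact _) := by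
        rw [e₁, ← hY, reassoc_of% h₁, Functor.map_comp]
    _ = _ := by
        rw [e₂, Functor.map_comp, reassoc_of% hX, ← h₂, ← reassoc_of% hb]

end

end StableCat

end

/-! ### The isomorphism of functors. -/

theorem mainTheorem10
    {A : Type u₁} [Category.{v₁} A] [Abelian A] [EnoughProjectives A] [HasDerivedCategory.{w₁} A]
    {B : Type u₂} [Category.{v₂} B] [Abelian B] [EnoughProjectives B] [HasDerivedCategory.{w₂} B]
    (F : DerivedCategory.Bounded A ⥤ DerivedCategory.Bounded B)
    [F.CommShift ℤ] [F.IsTriangulated] (hF : StableCat.IsNonnegative F)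
    (ξ : ∀ X : A, StableCat.StableTriangle F X)
    (p : ∀ X : A, ProjectivePresentation X) (q : ∀ Y : B, ProjectivePresentation Y) :
    Nonempty (StableCat.syzygyFunctor p ⋙ StableCat.stableFunctor F hF ξ ≅
      StableCat.stableFunctor F hF ξ ⋙ StableCat.syzygyFunctor q) := by
  choose β hβ hβ' using fun X => StableCat.exists_syzygy_comparison hF (p X) (ξ _) (ξ _) (ξ X)
    (q (ξ X).M)
  refine ⟨CategoryTheory.Quotient.natIsoLift _
    (NatIso.ofComponents (fun X => @asIso _ _ _ _ _ (hβ X)) fun {X Y} f => ?_)⟩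
  -- The lifts must be the ones chosen in `preStableFunctor`, so that `h` is definitionally the
  -- naturality square.
  have hb := ((ξ X).exists_lift (F.map ((StableCat.toBounded A).map f) ≫ (ξ Y).π)).choose_spec
  have hc := ((ξ _).exists_lift (F.map ((StableCat.toBounded A).map
    (StableCat.syzygyMap p f)) ≫ (ξ (StableCat.syzygyObj p Y)).π)).choose_spec
  have h := StableCat.syzygy_comparison_naturality hF ξ p q f (β X) (β Y) (hβ' X) (hβ' Y) _ hb _ hc
  rw [← StableCat.toStable_map_eq_iff, Functor.map_comp, Functor.map_comp] at h
  exact h
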